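/- Let $\mathcal M_d$ be the algebra of complex $d\times d$ matrices, with numerical range $W(A)=\{\langle Ax,x\rangle : x\in\mathbb C^d,\ \|x\|=1\}$ and numerical radius $w(A)=\sup\{|\langle Ax,x\rangle| : x\in\mathbb C^d,\ \|x\|=1\}$ (Euclidean norm). For $\gamma\in[0,\pi/2)$ write $A\in\Pi_\gamma$ if $W(A)\subseteq\{z\in\mathbb C:\operatorname{Re}z>0,\ |\operatorname{Im}z|\le(\tan\gamma)\operatorname{Re}z\}$. Call $A$ accretive-dissipative if $\frac{A+A^*}{2}$ and $\frac{A-A^*}{2i}$ are both positive definite. For $A\in\Pi_\gamma$ and $t>0$ let $$A^t=\frac1{2\pi i}\int_\Gamma z^t(zI-A)^{-1}\,dz,$$ where $z^t$ is the principal branch and $\Gamma$ is a positively oriented circle that encloses all eigenvalues of $A$ and lies, together with its interior, in $\mathbb C\setminus(-\infty,0]$ (such circles exist, and $A^t$ does not depend on the choice). Theorem. Let $\gamma\in[0,\pi/2)$ and $A\in\Pi_\gamma$. Then for all $n\in\mathbb N$, $$w(A)^{1/2^n}\le\left(\prod_{i=1}^{n}\left(1+2\sin^2\frac{\gamma}{2^i}\right)^{\frac1{2^{\,n+1-i}}}\right)w\!\left(A^{1/2^n}\right).$$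 Further, if $A$ is accretive-dissipative, then for all $n\in\mathbb N$, $$w(A)^{1/2^n}\le\left(\prod_{i=1}^{n}\left(1+\sin^2\frac{\gamma}{2^i}\right)^{\frac1{2^{\,n+1-i}}}\right)w\!\left(A^{1/2^n}\right).$$ -/

import Mathlib

/-- The value `⟨A x, x⟩` of the quadratic form of `A`. The inner product of Mathlib is linear in its
second argument, hence the order of the arguments. -/
noncomputable def quadForm {d : ℕ} (A : Matrix (Fin d) (Fin d) ℂ)
    (x : EuclideanSpace ℂ (Fin d)) : ℂ :=
  inner ℂ x (Matrix.toEuclideanCLM (𝕜 := ℂ) A x)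

/-- The numerical range `W(A) = {⟨A x, x⟩ : ‖x‖ = 1}`. -/
def numRange {d : ℕ} (A : Matrix (Fin d) (Fin d) ℂ) : Set ℂ :=
  {z | ∃ x : EuclideanSpace ℂ (Fin d), ‖x‖ = 1 ∧ quadForm A x = z}

/-- The numerical radius `w(A) = sup {|⟨A x, x⟩| : ‖x‖ = 1}`. -/
noncomputable def numRadius {d : ℕ} (A : Matrix (Fin d) (Fin d) ℂ) : ℝ :=
  sSup {r : ℝ | ∃ x : EuclideanSpace ℂ (Fin d), ‖x‖ = 1 ∧ ‖quadForm A x‖ = r}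

/-- The sector `S_γ = {z : Re z > 0, |Im z| ≤ (tan γ) Re z}`. -/
def sector (γ : ℝ) : Set ℂ :=
  {z | 0 < z.re ∧ |z.im| ≤ Real.tan γ * z.re}

/-- The class `Π_γ` of the sectorial matrices of index `γ ∈ [0, π/2)`. -/
def IsSectorial {d : ℕ} (γ : ℝ) (A : Matrix (Fin d) (Fin d) ℂ) : Prop :=
  (0 ≤ γ ∧ γ < Real.pi / 2) ∧ numRange A ⊆ sector γ

open scoped ComplexOrder in
/-- `Re A = (A + A*) / 2` and `Im A = (A - A*) / (2i)` are both positive definite. -/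
def IsAccretiveDissipative {d : ℕ} (A : Matrix (Fin d) (Fin d) ℂ) : Prop :=
  (realPart A : Matrix (Fin d) (Fin d) ℂ).PosDef ∧
    (imaginaryPart A : Matrix (Fin d) (Fin d) ℂ).PosDef

/-- The Dunford-Taylor integral `(2πi)⁻¹ ∮ f(z) (z I - A)⁻¹ dz` over the positively oriented circle
of centre `c` and radius `R`, computed entry by entry. -/
noncomputable def dunfordIntegral {d : ℕ} (f : ℂ → ℂ) (c : ℂ) (R : ℝ)
    (A : Matrix (Fin d) (Fin d) ℂ) : Matrix (Fin d) (Fin d) ℂ :=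
  Matrix.of fun j k =>
    (2 * (Real.pi : ℂ) * Complex.I)⁻¹ *
      ∮ z in C(c, R), f z * ((z • (1 : Matrix (Fin d) (Fin d) ℂ) - A)⁻¹) j k

/-- The circle of centre `c` and radius `R` has all eigenvalues of `A` in its interior, and lies
with its interior in the plane slit along `(-∞, 0]`, where the principal powers are analytic. -/
def IsAdmissibleCircle {d : ℕ} (A : Matrix (Fin d) (Fin d) ℂ) (c : ℂ) (R : ℝ) : Prop :=
  0 < R ∧ spectrum ℂ A ⊆ Metric.ball c R ∧ Metric.closedBall c R ⊆ Complex.slitPlane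

/-- A matrix whose numerical range lies in the open right half-plane has an admissible circle. -/
theorem exists_isAdmissibleCircle {d : ℕ} (A : Matrix (Fin d) (Fin d) ℂ)
    (hA : numRange A ⊆ {z : ℂ | 0 < z.re}) :
    ∃ p : ℂ × ℝ, IsAdmissibleCircle A p.1 p.2 := by
  have hspec : ∀ l ∈ spectrum ℂ A, 0 < l.re := by
    intro l hl
    rw [← AlgEquiv.spectrum_eq (Matrix.toLinAlgEquiv' (R := ℂ) (n := Fin d)) A] at hl
    have hev := Module.End.hasEigenvalue_iff_mem_spectrum.mpr hl
    obtain ⟨v, hv⟩ := hev.exists_hasEigenvector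
    have hv1 : A.mulVec v = l • v := hv.apply_eq_smul
    have hv0 : (WithLp.toLp 2 v : EuclideanSpace ℂ (Fin d)) ≠ 0 := by
      intro h
      exact hv.2 (by simpa using h)
    set y : EuclideanSpace ℂ (Fin d) := WithLp.toLp 2 v with hy
    have hAy : Matrix.toEuclideanCLM (𝕜 := ℂ) A y = l • y := by
      rw [hy, Matrix.toEuclideanCLM_toLp, hv1]; rfl
    refine hA ⟨((‖y‖⁻¹ : ℝ) : ℂ) • y, ?_, ?_⟩
    · have : ‖y‖ ≠ 0 := norm_ne_zero_iff.mpr hv0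
      rw [norm_smul]
      simp [this]
    · have : (‖y‖ : ℂ) ≠ 0 := by exact_mod_cast norm_ne_zero_iff.mpr hv0
      rw [quadForm, map_smul, hAy, inner_smul_left, inner_smul_right, inner_smul_right,
        inner_self_eq_norm_sq_to_K]
      simp only [Complex.conj_ofReal, Complex.coe_algebraMap]
      push_cast
      field_simp
  have hfin : (spectrum ℂ A).Finite := Matrix.finite_spectrum A
  have hK : ∀ᶠ K : ℝ in Filter.atTop, ∀ l ∈ spectrum ℂ A, ‖l - (K : ℂ)‖ < K := by
    rw [Filter.eventually_all_finite hfin]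
    intro l hl
    have hre := hspec l hl
    filter_upwards [Filter.eventually_gt_atTop ((l.re ^ 2 + l.im ^ 2) / (2 * l.re)),
      Filter.eventually_gt_atTop 0] with K h1 h2
    rw [div_lt_iff₀ (by positivity)] at h1
    refine lt_of_pow_lt_pow_left₀ 2 h2.le ?_
    rw [← Complex.normSq_eq_norm_sq, Complex.normSq_apply]
    simp only [Complex.sub_re, Complex.sub_im, Complex.ofReal_re, Complex.ofReal_im]
    nlinarith
  obtain ⟨K, hK1, hK0⟩ := (hK.and (Filter.eventually_gt_atTop 0)).exists
  have hR : ∀ᶠ R : ℝ in nhdsWithin K (Set.Iio K), ∀ l ∈ spectrum ℂ A, ‖l - (K : ℂ)‖ < R := by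
    rw [Filter.eventually_all_finite hfin]
    intro l hl
    exact nhdsWithin_le_nhds (Ioi_mem_nhds (hK1 l hl))
  have hR0 : ∀ᶠ R : ℝ in nhdsWithin K (Set.Iio K), 0 < R :=
    nhdsWithin_le_nhds (Ioi_mem_nhds hK0)
  obtain ⟨R, ⟨hR1, hR2⟩, hR3⟩ := ((hR.and hR0).and self_mem_nhdsWithin).exists
  refine ⟨((K : ℂ), R), hR2, fun l hl => by simpa [dist_eq_norm] using hR1 l hl, ?_⟩
  intro z hz
  left
  have hz1 : ‖z - (K : ℂ)‖ ≤ R := by simpa [dist_eq_norm] using hz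
  have hz2 := (Complex.abs_re_le_norm (z - (K : ℂ))).trans hz1
  have hz3 := (abs_le.mp hz2).1
  have hR4 : R < K := hR3
  simp only [Complex.sub_re, Complex.ofReal_re] at hz3
  linarith

open Classical in
/-- The principal power `A ^ t = (2πi)⁻¹ ∮ z ^ t (z I - A)⁻¹ dz` of a matrix, by the Dunford-Taylor
integral over an admissible circle; by Cauchy's theorem the choice of the circle does not matter.
Every matrix whose numerical range lies in the open right half-plane has an admissible circle
(`exists_isAdmissibleCircle`); the value 0 for matrices without one is a placeholder. -/
noncomputable def matPow {d : ℕ} (A : Matrix (Fin d) (Fin d) ℂ) (t : ℝ) :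
    Matrix (Fin d) (Fin d) ℂ :=
  if h : ∃ p : ℂ × ℝ, IsAdmissibleCircle A p.1 p.2 then
    dunfordIntegral (fun z => z ^ (t : ℂ)) h.choose.1 h.choose.2 A
  else 0

/-! Everything rests on one squaring step. Let B = A^(1/2^(n+1)), so that B² = A^(1/2^n), and let δ
= γ/2^(n+1) ≤ π/4. If W(B) lies in a closed sector of half-angle δ, then ‖B‖ ≤ w(B) sec δ
(`opNorm_le_div_cos`), hence w(B²) ≤ ‖B‖² ≤ sec² δ w(B)², and sec² δ ≤ 1 + 2 sin² δ. In the
accretive-dissipative case W(B) lies between the directions 0 and δ, a sector of half-angle δ/2, and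
sec² (δ/2) ≤ 1 + sin² δ. Chaining these estimates under square roots gives the product
(`rpow_le_prod_mul_of_le_mul_sq`).

That the angle halves with each square root is a Lyapunov argument
(`im_inner_nonneg_of_im_inner_mul_self`): if C has its spectrum in the right half-plane and Im C² ≥
0, then Im C ≥ 0. Applied to rotations of B, it moves each edge of the sector to half its angle.

The powers are handled algebraically: z^t = p(z) + χ(z) g(z) with χ the characteristic polynomial
and g holomorphic, so A^t = p(A) by Cayley-Hamilton. The law of exponents and the location of the
eigenvalues follow. -/

/-! ### Holomorphic functional calculus and principal powers -/

open Filter Topology Metric Polynomial in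
/-- The Dunford-Taylor integral of the constant function `1` is the unit. -/
theorem circleIntegral_resolvent {𝔸 : Type*} [NormedRing 𝔸] [NormedAlgebra ℂ 𝔸] [CompleteSpace 𝔸]
    (a : 𝔸) {c : ℂ} {R : ℝ} (hR : 0 < R) (ha : spectrum ℂ a ⊆ ball c R) :
    (∮ z in C(c, R), resolvent a z) = (2 * Real.pi * Complex.I : ℂ) • (1 : 𝔸) := by
  have hres : ∀ z, z ∉ ball c R → z ∈ resolventSet ℂ a := fun z hz => by
    by_contra h
    exact hz (ha h)
  have hdiff : ∀ z, z ∉ ball c R → DifferentiableAt ℂ (resolvent a) z := fun z hz =>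
    (spectrum.hasDerivAt_resolvent_const_left (hres z hz)).differentiableAt
  have hrad : ∀ R', R ≤ R' → (∮ z in C(c, R'), resolvent a z) = ∮ z in C(c, R), resolvent a z :=
    fun R' h => Complex.circleIntegral_eq_of_differentiable_on_annulus_off_countable hR h
      Set.countable_empty (fun z hz => (hdiff z hz.2).continuousAt.continuousWithinAt)
      (fun z hz => hdiff z fun h => hz.1.2 (ball_subset_closedBall h))
  set b : 𝔸 := a - algebraMap ℂ 𝔸 c
  -- On a large circle the resolvent differs from (z - c)⁻¹ by (z - c)⁻¹ b times the resolvent,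
  -- which is o(1/|z|); the length of the circle absorbs the factor 1/R'.
  have hkey : ∀ ε > 0, ‖(∮ z in C(c, R), resolvent a z) -
      (2 * Real.pi * Complex.I : ℂ) • (1 : 𝔸)‖ ≤ 2 * Real.pi * (‖b‖ * ε) := by
    intro ε hε
    have h1 : ∀ᶠ z in Bornology.cobounded ℂ, ‖resolvent a z‖ < ε := by
      have := (spectrum.resolvent_tendsto_cobounded (𝕜 := ℂ) a).norm
      rw [norm_zero] at this
      exact this.eventually_lt_const hε
    rw [(Metric.hasBasis_cobounded_compl_closedBall c).eventually_iff] at h1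
    obtain ⟨r, -, hr⟩ := h1
    set R' := max R (r + 1)
    have hR' : 0 < R' := hR.trans_le (le_max_left _ _)
    have hout : ∀ z ∈ sphere c R', z ∉ ball c R := fun z hz h => by
      have h2 := mem_ball.mp h
      rw [mem_sphere.mp hz] at h2
      exact absurd h2 (not_lt.mpr (le_max_left _ _))
    rw [← hrad R' (le_max_left _ _), ← circleIntegral.integral_sub_center_inv c hR'.ne',
      ← circleIntegral.integral_smul_const, ← circleIntegral.integral_sub]
    · have hb : 2 * Real.pi * (‖b‖ * ε) = 2 * Real.pi * R' * (R'⁻¹ * (‖b‖ * ε)) := by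
        field_simp
      rw [hb]
      refine circleIntegral.norm_integral_le_of_norm_le_const hR'.le fun z hz => ?_
      have hz1 : ‖z - c‖ = R' := by simpa [dist_eq_norm] using hz
      have hz0 : z - c ≠ 0 := norm_pos_iff.mp (hz1 ▸ hR')
      have hid : resolvent a z - (z - c)⁻¹ • (1 : 𝔸) = (z - c)⁻¹ • (b * resolvent a z) := by
        have h3 : (algebraMap ℂ 𝔸 z - a) * resolvent a z = 1 :=
          Ring.mul_inverse_cancel _ (hres z (hout z hz))
        have h4 : b = algebraMap ℂ 𝔸 (z - c) - (algebraMap ℂ 𝔸 z - a) := by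
          simp only [b, map_sub]; abel
        rw [h4, sub_mul, h3, smul_sub, ← Algebra.smul_def, smul_smul, inv_mul_cancel₀ hz0, one_smul]
      rw [hid, norm_smul, norm_inv, hz1]
      gcongr
      refine (norm_mul_le _ _).trans ?_
      gcongr
      refine (hr ?_).le
      simp only [Set.mem_compl_iff, mem_closedBall, dist_eq_norm, hz1, not_le]
      exact (lt_add_one r).trans_le (le_max_right _ _)
    · exact ContinuousOn.circleIntegrable hR'.le fun z hz =>
        (hdiff z (hout z hz)).continuousAt.continuousWithinAt
    · refine ContinuousOn.circleIntegrable hR'.le ?_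
      refine ContinuousOn.smul (ContinuousOn.inv₀ (by fun_prop) fun z hz h => ?_) (by fun_prop)
      have hz1 : ‖z - c‖ = R' := by simpa [dist_eq_norm] using hz
      rw [h, norm_zero] at hz1
      exact hR'.ne hz1
  rw [← sub_eq_zero, ← norm_le_zero_iff]
  have hlim : Tendsto (fun ε : ℝ => 2 * Real.pi * (‖b‖ * ε)) (𝓝[>] 0) (𝓝 0) := by
    have : Continuous fun ε : ℝ => 2 * Real.pi * (‖b‖ * ε) := by fun_prop
    simpa using (this.tendsto 0).mono_left nhdsWithin_le_nhds
  exact ge_of_tendsto hlim (eventually_mem_nhdsWithin.mono fun ε hε => hkey ε hε)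

open Polynomial in
/-- `p z - p a` is divisible by `z - a`, with a quotient that is entire in `z`. -/
theorem exists_sub_mul_eq_eval_sub_aeval {𝔸 : Type*} [NormedRing 𝔸] [NormedAlgebra ℂ 𝔸]
    (a : 𝔸) (p : ℂ[X]) : ∃ q : ℂ → 𝔸, Differentiable ℂ q ∧
      ∀ z, q z * (algebraMap ℂ 𝔸 z - a) = algebraMap ℂ 𝔸 (p.eval z) - aeval a p := by
  induction p using Polynomial.induction_on' with
  | add p₁ p₂ h₁ h₂ =>
    obtain ⟨q₁, hd₁, hq₁⟩ := h₁
    obtain ⟨q₂, hd₂, hq₂⟩ := h₂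
    refine ⟨q₁ + q₂, hd₁.add hd₂, fun z => ?_⟩
    rw [Pi.add_apply, add_mul, hq₁, hq₂, eval_add, map_add, map_add]
    abel
  | monomial n r =>
    refine ⟨fun z => r • ∑ i ∈ Finset.range n, z ^ i • a ^ (n - 1 - i), by fun_prop, fun z => ?_⟩
    have hcomm : Commute (algebraMap ℂ 𝔸 z) a := Algebra.commutes z a
    have := hcomm.geom_sum₂_mul n
    simp only [← map_pow, ← Algebra.smul_def] at this
    dsimp only
    rw [smul_mul_assoc, this, eval_monomial, aeval_monomial, map_mul, smul_sub, ← Algebra.smul_def,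
      ← Algebra.smul_def]

open Metric Polynomial in
/-- If `f` agrees with the polynomial `p` up to a multiple of a polynomial that annihilates `a`,
then the Dunford-Taylor integral of `f` at `a` is `p(a)`. -/
theorem circleIntegral_smul_resolvent_eq_aeval {𝔸 : Type*} [NormedRing 𝔸] [NormedAlgebra ℂ 𝔸]
    [CompleteSpace 𝔸] (a : 𝔸) {c : ℂ} {R : ℝ} (hR : 0 < R) (ha : spectrum ℂ a ⊆ ball c R)
    {χ p : ℂ[X]} (hχ : aeval a χ = 0) {f g : ℂ → ℂ} (hg : DifferentiableOn ℂ g (closedBall c R))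
    (hf : ∀ z ∈ sphere c R, f z = p.eval z + χ.eval z * g z) :
    (∮ z in C(c, R), f z • resolvent a z) = (2 * Real.pi * Complex.I : ℂ) • aeval a p := by
  obtain ⟨q, hqd, hq⟩ := exists_sub_mul_eq_eval_sub_aeval a p
  obtain ⟨s, hsd, hs⟩ := exists_sub_mul_eq_eval_sub_aeval a χ
  have hres : ∀ z ∈ sphere c R, z ∈ resolventSet ℂ a := fun z hz => by
    by_contra h
    exact absurd (mem_sphere.mp hz) (mem_ball.mp (ha h)).ne
  have hcont : ContinuousOn (resolvent a) (sphere c R) := fun z hz =>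
    (spectrum.hasDerivAt_resolvent_const_left (hres z hz)).continuousAt.continuousWithinAt
  have hcancel : ∀ z ∈ sphere c R, (algebraMap ℂ 𝔸 z - a) * resolvent a z = 1 := fun z hz =>
    Ring.mul_inverse_cancel _ (hres z hz)
  -- The part of the integrand in which the pole cancels: p(z) times the resolvent is p(a) times the
  -- resolvent plus q(z), and χ(z) times the resolvent is s(z) because χ(a) = 0. Its integral
  -- vanishes by Cauchy's theorem.
  set h : ℂ → 𝔸 := fun z => q z + g z • s z
  have hhd : DifferentiableOn ℂ h (closedBall c R) :=
    hqd.differentiableOn.add (hg.smul hsd.differentiableOn)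
  have heq : Set.EqOn (fun z => f z • resolvent a z)
      (fun z => aeval a p * resolvent a z + h z) (sphere c R) := by
    intro z hz
    have h1 : p.eval z • resolvent a z = aeval a p * resolvent a z + q z := by
      have := congrArg (· * resolvent a z) (hq z)
      simp only [mul_assoc, hcancel z hz, mul_one, sub_mul, ← Algebra.smul_def] at this
      rw [this]; abel
    have h2 : χ.eval z • resolvent a z = s z := by
      have := congrArg (· * resolvent a z) (hs z)
      simp only [mul_assoc, hcancel z hz, mul_one, hχ, sub_zero, ← Algebra.smul_def] at this
      exact this.symm
    simp only [hf z hz, add_smul, h1, mul_comm (χ.eval z), mul_smul, h2, h]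
    abel
  rw [circleIntegral.integral_congr hR.le heq, circleIntegral.integral_add,
    (hhd.mono closure_ball_subset_closedBall).diffContOnCl.circleIntegral_eq_zero hR.le, add_zero]
  · have := ContinuousLinearMap.intervalIntegral_comp_comm (μ := MeasureTheory.volume)
      (ContinuousLinearMap.mul ℂ 𝔸 (aeval a p))
      ((ContinuousOn.circleIntegrable hR.le hcont).out)
    simp only [ContinuousLinearMap.mul_apply', mul_smul_comm] at this
    rw [circleIntegral, this, ← circleIntegral, circleIntegral_resolvent a hR ha, mul_smul_comm,
      mul_one]
  · exact ContinuousOn.circleIntegrable hR.le (continuousOn_const.mul hcont)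
  · exact ContinuousOn.circleIntegrable hR.le (hhd.continuousOn.mono sphere_subset_closedBall)

open Polynomial in
/-- Division of a holomorphic function by a polynomial with zeros in its domain. -/
theorem exists_eq_eval_add_prod_mul {U : Set ℂ} (hU : IsOpen U) {f : ℂ → ℂ}
    (hf : DifferentiableOn ℂ f U) (s : Multiset ℂ) (hs : ∀ l ∈ s, l ∈ U) :
    ∃ (p : ℂ[X]) (g : ℂ → ℂ), DifferentiableOn ℂ g U ∧
      ∀ z, f z = p.eval z + ((s.map fun l => X - C l).prod).eval z * g z := by
  induction s using Multiset.induction_on with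
  | empty => exact ⟨0, f, hf, by simp⟩
  | cons l s ih =>
    obtain ⟨p, g, hg, hfg⟩ := ih fun m hm => hs m (Multiset.mem_cons_of_mem hm)
    -- Split off one root: g(z) = g(l) + (z - l) `dslope g l z`, with a removable singularity at l.
    refine ⟨p + (s.map fun l => X - C l).prod * C (g l), dslope g l,
      (Complex.differentiableOn_dslope (hU.mem_nhds (hs l (Multiset.mem_cons_self l s)))).mpr hg,
      fun z => ?_⟩
    have := sub_smul_dslope g l z
    rw [smul_eq_mul] at this
    simp only [Multiset.map_cons, Multiset.prod_cons, eval_add, eval_mul, eval_sub, eval_X, eval_C]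
    rw [hfg z]
    linear_combination -((s.map fun l => X - C l).prod).eval z * this

attribute [local instance] Matrix.linftyOpNormedRing Matrix.linftyOpNormedAlgebra in
open Polynomial in
/-- The Dunford-Taylor integral of a function that is polynomial up to a holomorphic multiple of the
characteristic polynomial. -/
theorem dunfordIntegral_eq_aeval {d : ℕ} {A : Matrix (Fin d) (Fin d) ℂ} {c : ℂ} {R : ℝ}
    (h : IsAdmissibleCircle A c R) {f g : ℂ → ℂ} {p : ℂ[X]}
    (hg : DifferentiableOn ℂ g Complex.slitPlane)
    (hf : ∀ z ∈ Complex.slitPlane, f z = p.eval z + A.charpoly.eval z * g z) :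
    dunfordIntegral f c R A = aeval A p := by
  obtain ⟨hR, hs, hU⟩ := h
  have hres : ∀ z ∈ Metric.sphere c R, z ∈ resolventSet ℂ A := fun z hz => by
    by_contra h
    exact absurd (Metric.mem_sphere.mp hz) (Metric.mem_ball.mp (hs h)).ne
  have hf' : ∀ z ∈ Metric.sphere c R, f z = p.eval z + A.charpoly.eval z * g z := fun z hz =>
    hf z (hU (Metric.sphere_subset_closedBall hz))
  have hint := circleIntegral_smul_resolvent_eq_aeval A hR hs A.aeval_self_charpoly (hg.mono hU) hf'
  have hfc : ContinuousOn f (Metric.sphere c R) :=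
    ContinuousOn.congr (p.continuous.continuousOn.add (A.charpoly.continuous.continuousOn.mul
      (hg.continuousOn.mono (Metric.sphere_subset_closedBall.trans hU)))) hf'
  have hci : CircleIntegrable (fun z => f z • resolvent A z) c R :=
    ContinuousOn.circleIntegrable hR.le <| hfc.smul fun z hz =>
      (spectrum.hasDerivAt_resolvent_const_left (hres z hz)).continuousAt.continuousWithinAt
  ext j k
  let L : Matrix (Fin d) (Fin d) ℂ →L[ℂ] ℂ :=
    LinearMap.toContinuousLinearMap (Matrix.entryLinearMap ℂ ℂ j k)
  have hL := L.intervalIntegral_comp_comm hci.out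
  have hentry : (∮ z in C(c, R), f z * ((z • (1 : Matrix (Fin d) (Fin d) ℂ) - A)⁻¹) j k) =
      L (∮ z in C(c, R), f z • resolvent A z) := by
    rw [circleIntegral, circleIntegral]
    refine Eq.trans ?_ hL
    refine intervalIntegral.integral_congr fun θ _ => ?_
    simp [L, resolvent, Matrix.nonsing_inv_eq_ringInverse, Algebra.algebraMap_eq_smul_one]
    rfl
  rw [dunfordIntegral, Matrix.of_apply, hentry, hint]
  have hpi : (2 * Real.pi * Complex.I : ℂ) ≠ 0 := Complex.two_pi_I_ne_zero
  rw [map_smul, smul_eq_mul, inv_mul_cancel_left₀ hpi]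
  rfl

open Polynomial in
/-- The principal power is a polynomial in the matrix, determined by the power function up to
holomorphic multiples of the characteristic polynomial. -/
theorem matPow_eq_aeval {d : ℕ} {A : Matrix (Fin d) (Fin d) ℂ}
    (h : ∃ p : ℂ × ℝ, IsAdmissibleCircle A p.1 p.2) (t : ℝ) {g : ℂ → ℂ} {p : ℂ[X]}
    (hg : DifferentiableOn ℂ g Complex.slitPlane)
    (hp : ∀ z ∈ Complex.slitPlane, z ^ (t : ℂ) = p.eval z + A.charpoly.eval z * g z) :
    matPow A t = aeval A p := by
  rw [matPow, dif_pos h]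
  exact dunfordIntegral_eq_aeval h.choose_spec hg hp

-- The eigenvalues lie in the slit plane, where the power is holomorphic, so the roots of the
-- characteristic polynomial can be divided out one by one, with multiplicity.
open Polynomial in
theorem exists_cpow_eq_eval_add_charpoly_mul {d : ℕ} {A : Matrix (Fin d) (Fin d) ℂ}
    (h : ∃ p : ℂ × ℝ, IsAdmissibleCircle A p.1 p.2) (t : ℝ) :
    ∃ (p : ℂ[X]) (g : ℂ → ℂ), DifferentiableOn ℂ g Complex.slitPlane ∧
      ∀ z, z ^ (t : ℂ) = p.eval z + A.charpoly.eval z * g z := by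
  obtain ⟨q, hR, hs, hU⟩ := h
  have hf : DifferentiableOn ℂ (fun z : ℂ => z ^ (t : ℂ)) Complex.slitPlane := fun z hz =>
    (differentiableAt_id.cpow_const hz).differentiableWithinAt
  obtain ⟨p, g, hg, hp⟩ := exists_eq_eval_add_prod_mul Complex.isOpen_slitPlane hf A.charpoly.roots
    fun l hl => hU (Metric.ball_subset_closedBall
      (hs (Matrix.mem_spectrum_iff_isRoot_charpoly.mpr (isRoot_of_mem_roots hl))))
  refine ⟨p, g, hg, fun z => ?_⟩
  rw [hp z, ← (IsAlgClosed.splits A.charpoly).eq_prod_roots_of_monic A.charpoly_monic]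

theorem matPow_one {d : ℕ} {A : Matrix (Fin d) (Fin d) ℂ}
    (h : ∃ p : ℂ × ℝ, IsAdmissibleCircle A p.1 p.2) : matPow A 1 = A := by
  have := matPow_eq_aeval h 1 (g := 0) (p := Polynomial.X) (differentiableOn_const 0) (by simp)
  rwa [Polynomial.aeval_X] at this

/-- Multiplying the expansions p + χg and q + χk of the two powers gives pq plus a holomorphic
multiple of χ, so pq represents the exponent s + t. -/
theorem matPow_add {d : ℕ} {A : Matrix (Fin d) (Fin d) ℂ}
    (h : ∃ p : ℂ × ℝ, IsAdmissibleCircle A p.1 p.2) (s t : ℝ) :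
    matPow A (s + t) = matPow A s * matPow A t := by
  obtain ⟨p, g, hg, hp⟩ := exists_cpow_eq_eval_add_charpoly_mul h s
  obtain ⟨q, k, hk, hq⟩ := exists_cpow_eq_eval_add_charpoly_mul h t
  rw [matPow_eq_aeval h s hg fun z _ => hp z, matPow_eq_aeval h t hk fun z _ => hq z, ← map_mul]
  refine matPow_eq_aeval h (s + t)
    (g := fun z => p.eval z * k z + q.eval z * g z + A.charpoly.eval z * (g z * k z)) ?_ ?_
  · have hpoly : ∀ r : Polynomial ℂ, DifferentiableOn ℂ (fun z => r.eval z) Complex.slitPlane :=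
      fun r => r.differentiable.differentiableOn
    exact (((hpoly p).mul hk).add ((hpoly q).mul hg)).add ((hpoly _).mul (hg.mul hk))
  · intro z hz
    rw [Complex.ofReal_add, Complex.cpow_add _ _ (Complex.slitPlane_ne_zero hz), hp z, hq z,
      Polynomial.eval_mul]
    ring

/-- Spectral mapping for the representing polynomial p: since χ vanishes at each eigenvalue l, p(l)
= l^t. -/
theorem exists_cpow_eq_of_mem_spectrum_matPow {d : ℕ} {A : Matrix (Fin d) (Fin d) ℂ}
    (h : ∃ p : ℂ × ℝ, IsAdmissibleCircle A p.1 p.2) (t : ℝ) {m : ℂ}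
    (hm : m ∈ spectrum ℂ (matPow A t)) : ∃ l ∈ spectrum ℂ A, l ^ (t : ℂ) = m := by
  obtain ⟨p, g, hg, hp⟩ := exists_cpow_eq_eval_add_charpoly_mul h t
  rw [matPow_eq_aeval h t hg fun z _ => hp z] at hm
  rcases isEmpty_or_nonempty (Fin d) with hd | hd
  · exact absurd hm (by simp [spectrum.of_subsingleton])
  rw [spectrum.map_polynomial_aeval_of_nonempty A p
    (spectrum.nonempty_of_isAlgClosed_of_finiteDimensional ℂ A)] at hm
  obtain ⟨l, hl, rfl⟩ := hm
  refine ⟨l, hl, ?_⟩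
  have h0 : A.charpoly.eval l = 0 := Matrix.mem_spectrum_iff_isRoot_charpoly.mp hl
  rw [hp l, h0, zero_mul, add_zero]

/-! ### Spectra, the Cayley transform and a Lyapunov inequality -/

/-- The spectrum is contained in the numerical range. -/
theorem spectrum_subset_numRange {d : ℕ} (A : Matrix (Fin d) (Fin d) ℂ) :
    spectrum ℂ A ⊆ numRange A := by
  intro l hl
  rw [← AlgEquiv.spectrum_eq (Matrix.toLinAlgEquiv' (R := ℂ) (n := Fin d)) A] at hl
  obtain ⟨v, hv⟩ := (Module.End.hasEigenvalue_iff_mem_spectrum.mpr hl).exists_hasEigenvector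
  have hv1 : A.mulVec v = l • v := hv.apply_eq_smul
  set y : EuclideanSpace ℂ (Fin d) := WithLp.toLp 2 v with hy
  have hv0 : ‖y‖ ≠ 0 := norm_ne_zero_iff.mpr fun h => hv.2 (by simpa [hy] using h)
  have hAy : Matrix.toEuclideanCLM (𝕜 := ℂ) A y = l • y := by
    rw [hy, Matrix.toEuclideanCLM_toLp, hv1]; rfl
  refine ⟨((‖y‖⁻¹ : ℝ) : ℂ) • y, by rw [norm_smul]; simp [hv0], ?_⟩
  have : (‖y‖ : ℂ) ≠ 0 := by exact_mod_cast hv0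
  rw [quadForm, map_smul, hAy, inner_smul_left, inner_smul_right, inner_smul_right,
    inner_self_eq_norm_sq_to_K]
  simp only [Complex.conj_ofReal, Complex.coe_algebraMap]
  push_cast
  field_simp

open Filter Topology in
/-- Powers of an element whose spectrum lies in the open unit disc tend to zero. -/
theorem tendsto_pow_nhds_zero_of_spectrum {𝔸 : Type*} [NormedRing 𝔸] [NormedAlgebra ℂ 𝔸]
    [CompleteSpace 𝔸] (a : 𝔸) (ha : ∀ z ∈ spectrum ℂ a, ‖z‖ < 1) :
    Tendsto (fun n : ℕ => a ^ n) atTop (𝓝 0) := by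
  have hr : spectralRadius ℂ a < 1 := by
    rcases (spectrum ℂ a).eq_empty_or_nonempty with h | h
    · simp [spectralRadius, h]
    · exact_mod_cast spectrum.spectralRadius_lt_of_forall_lt_of_nonempty h (r := 1)
        fun z hz => by exact_mod_cast ha z hz
  obtain ⟨r, hr0, hr1⟩ := ENNReal.lt_iff_exists_nnreal_btwn.mp hr
  -- By Gelfand's formula ‖aⁿ‖ < rⁿ eventually, for a fixed r < 1.
  have hev := (spectrum.pow_nnnorm_pow_one_div_tendsto_nhds_spectralRadius a).eventually_lt_const hr0
  rw [tendsto_zero_iff_norm_tendsto_zero]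
  refine squeeze_zero' (Eventually.of_forall fun n => norm_nonneg _) ?_
    (tendsto_pow_atTop_nhds_zero_of_lt_one r.coe_nonneg (by exact_mod_cast hr1))
  filter_upwards [hev, eventually_ne_atTop 0] with n hn hn0
  have h1 : ((‖a ^ n‖₊ : ENNReal) ^ (1 / n : ℝ)) ^ (n : ℝ) ≤ (r : ENNReal) ^ (n : ℝ) :=
    ENNReal.rpow_le_rpow hn.le n.cast_nonneg
  rw [← ENNReal.rpow_mul, one_div_mul_cancel (Nat.cast_ne_zero.mpr hn0), ENNReal.rpow_one,
    ENNReal.rpow_natCast] at h1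
  exact_mod_cast h1

/-- The Cayley transform of an element with spectrum in the right half-plane has its spectrum in
the open unit disc. -/
theorem norm_lt_one_of_mem_spectrum_cayley {𝔸 : Type*} [Ring 𝔸] [Algebra ℂ 𝔸] {a : 𝔸}
    (ha : ∀ z ∈ spectrum ℂ a, 0 < z.re) {b : 𝔸} (hab : (1 + a) * b = 1) (hba : b * (1 + a) = 1)
    {z : ℂ} (hz : z ∈ spectrum ℂ ((1 - a) * b)) : ‖z‖ < 1 := by
  by_contra! hz1
  refine hz ?_
  have hb : IsUnit b := ⟨⟨b, 1 + a, hba, hab⟩, rfl⟩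
  have heq : algebraMap ℂ 𝔸 z - (1 - a) * b =
      (algebraMap ℂ 𝔸 (z - 1) + algebraMap ℂ 𝔸 (z + 1) * a) * b := by
    have : algebraMap ℂ 𝔸 z = algebraMap ℂ 𝔸 z * ((1 + a) * b) := by rw [hab, mul_one]
    rw [this, map_sub, map_add, map_one]
    noncomm_ring
  change IsUnit _
  rw [heq]
  refine IsUnit.mul ?_ hb
  by_cases h : z + 1 = 0
  · have hz2 : z = -1 := eq_neg_of_add_eq_zero_left h
    rw [h, map_zero, zero_mul, add_zero]
    exact (IsUnit.mk0 (z - 1) (by rw [hz2]; norm_num)).map (algebraMap ℂ 𝔸)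
  -- The Cayley map sends |z| ≥ 1 to the closed left half-plane, which contains no spectrum of a.
  · have hu : IsUnit (algebraMap ℂ 𝔸 ((1 - z) / (z + 1)) - a) := by
      by_contra hn
      have h1 := ha _ hn
      have h2 : ((1 - z) / (z + 1)).re = (1 - ‖z‖ ^ 2) / Complex.normSq (z + 1) := by
        rw [Complex.div_re, ← Complex.normSq_eq_norm_sq, ← add_div, Complex.normSq_apply z]
        simp
        ring_nf
      rw [h2] at h1
      have h3 : (1 - ‖z‖ ^ 2) / Complex.normSq (z + 1) ≤ 0 :=
        div_nonpos_of_nonpos_of_nonneg (by nlinarith) (Complex.normSq_nonneg _)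
      linarith
    have h4 : algebraMap ℂ 𝔸 (z - 1) + algebraMap ℂ 𝔸 (z + 1) * a =
        algebraMap ℂ 𝔸 (-(z + 1)) * (algebraMap ℂ 𝔸 ((1 - z) / (z + 1)) - a) := by
      rw [mul_sub, ← map_mul, map_neg _ (z + 1), neg_mul (algebraMap ℂ 𝔸 (z + 1)), sub_neg_eq_add]
      congr 2
      field_simp
      ring
    rw [h4]
    exact ((IsUnit.mk0 _ (neg_ne_zero.mpr h)).map (algebraMap ℂ 𝔸)).mul hu

open Filter Topology in
/-- A Lyapunov-type inequality: if `C` has its spectrum in the right half-plane, then the sign of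
`Im C²` is inherited by `Im C`. -/
theorem im_inner_nonneg_of_im_inner_mul_self {E : Type*} [NormedAddCommGroup E]
    [InnerProductSpace ℂ E] [CompleteSpace E] (C : E →L[ℂ] E)
    (hC : ∀ z ∈ spectrum ℂ C, 0 < z.re) (σ : ℝ)
    (hC2 : ∀ x, 0 ≤ σ * (inner ℂ x ((C * C) x)).im) (x : E) : 0 ≤ σ * (inner ℂ x (C x)).im := by
  have hunit : IsUnit (1 + C) := by
    have h : (-1 : ℂ) ∈ resolventSet ℂ C := by
      by_contra h
      have := hC _ h
      norm_num at this
    have h1 : IsUnit (algebraMap ℂ (E →L[ℂ] E) (-1) - C) := h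
    rw [map_neg, map_one] at h1
    simpa [add_comm] using h1.neg
  obtain ⟨u, hu⟩ := hunit
  have hab : (1 + C) * (↑u⁻¹ : E →L[ℂ] E) = 1 := by rw [← hu, u.mul_inv]
  have hba : (↑u⁻¹ : E →L[ℂ] E) * (1 + C) = 1 := by rw [← hu, u.inv_mul]
  set T : E →L[ℂ] E := (1 - C) * ↑u⁻¹
  set Q : E → ℝ := fun x => σ * (inner ℂ x (C x)).im with hQ
  -- With x = y + Cy and Tx = y - Cy, the decrease Q(x) - Q(Tx) is 2σ Im⟨y, C²y⟩. As Tⁿ → 0,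
  -- iterating gives Q(x) ≥ lim Q(Tⁿx) = 0.
  have hstep : ∀ x, Q (T x) ≤ Q x := by
    intro x
    set y := (↑u⁻¹ : E →L[ℂ] E) x
    have hx : x = y + C y := by
      have := congrArg (fun S : E →L[ℂ] E => S x) hab
      simpa using this.symm
    have hT : T x = y - C y := by simp [T, y]
    have h1 := hC2 y
    rw [mul_apply_eq_comp] at h1
    have h2 : (inner ℂ (C y) (C y)).im = 0 := inner_self_im (𝕜 := ℂ) (C y)
    have h3 : Q x - Q (T x) = 2 * (σ * (inner ℂ y (C (C y))).im) := by
      rw [hT]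
      nth_rw 1 [hx]
      simp only [hQ, map_add, map_sub, inner_add_left, inner_add_right, inner_sub_left,
        inner_sub_right, Complex.add_im, Complex.sub_im, h2]
      ring
    linarith
  have hpow : ∀ n : ℕ, Q ((T ^ n) x) ≤ Q x := by
    intro n
    induction n with
    | zero => simp
    | succ n ih =>
      rw [pow_succ', mul_apply_eq_comp]
      exact (hstep _).trans ih
  have hlim : Tendsto (fun n : ℕ => Q ((T ^ n) x)) atTop (𝓝 0) := by
    have hT : Tendsto (fun n : ℕ => (T ^ n) x) atTop (𝓝 0) := by
      have := tendsto_pow_nhds_zero_of_spectrum T fun z hz =>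
        norm_lt_one_of_mem_spectrum_cayley hC hab hba hz
      exact ((ContinuousLinearMap.apply ℂ E x).continuous.tendsto' 0 0 (map_zero _)).comp this
    have hQc : Continuous Q := by
      simp only [hQ]
      fun_prop
    exact (hQc.tendsto' 0 0 (by simp [hQ])).comp hT
  exact le_of_tendsto hlim (Eventually.of_forall hpow)

/-! ### Norm bounds from a sectorial numerical range -/

/-- Mixed Schwarz inequality for an operator whose numerical range lies in a sector. -/
theorem two_mul_cos_mul_re_inner_le {E : Type*} [NormedAddCommGroup E] [InnerProductSpace ℂ E]
    (T : E →L[ℂ] E) {δ : ℝ} (hδ0 : 0 ≤ δ) (hδ : δ < Real.pi / 2)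
    (hre : ∀ x, 0 ≤ (inner ℂ x (T x)).re)
    (him : ∀ x, |(inner ℂ x (T x)).im| * Real.cos δ ≤ Real.sin δ * (inner ℂ x (T x)).re) (x y : E) :
    2 * Real.cos δ * (inner ℂ y (T x)).re ≤ (inner ℂ x (T x)).re + (inner ℂ y (T y)).re := by
  rcases hδ0.eq_or_lt with rfl | hδ0
  -- The form is real, so `h1` gives Re⟨x, Ty⟩ = Re⟨y, Tx⟩ by polarization, and positivity at x - y
  -- suffices.
  · have him0 : ∀ x, (inner ℂ x (T x)).im = 0 := fun x => by simpa using him x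
    have h1 := him0 (x + Complex.I • y)
    have h2 := hre (x - y)
    simp only [map_add, map_sub, map_smul, inner_add_left, inner_add_right, inner_sub_left,
      inner_sub_right, inner_smul_left, inner_smul_right, Complex.conj_I] at h1 h2
    simp [him0 x, him0 y] at h1 h2
    rw [Real.cos_zero]
    linarith
  · set s := Real.sin δ
    set c := Real.cos δ
    have hs : 0 < s := Real.sin_pos_of_pos_of_lt_pi hδ0 (by linarith [Real.pi_pos])
    have hc : 0 < c := Real.cos_pos_of_mem_Ioo ⟨by linarith [Real.pi_pos], hδ⟩
    have hsc : s ^ 2 + c ^ 2 = 1 := Real.sin_sq_add_cos_sq δ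
    set u : ℂ := ⟨c, s⟩
    set v : ℂ := ⟨c, -s⟩
    have hm1 : ∀ z, 0 ≤ s * (inner ℂ z (T z)).re + c * (inner ℂ z (T z)).im := fun z => by
      nlinarith [him z, neg_abs_le (inner ℂ z (T z)).im]
    have hm2 : ∀ z, 0 ≤ s * (inner ℂ z (T z)).re - c * (inner ℂ z (T z)).im := fun z => by
      nlinarith [him z, le_abs_self (inner ℂ z (T z)).im]
    -- The phases u = e^(iδ) and v = e^(-iδ) make the ⟨x, Ty⟩ terms cancel in the sum of `h1` and
    -- `h2`; what remains is 2s times the desired difference.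
    have h1 := hm1 (u • x - y)
    have h2 := hm2 (v • x - y)
    have hu : (starRingEnd ℂ) u = v := rfl
    have hv : (starRingEnd ℂ) v = u := by simp [u, v, Complex.ext_iff]
    simp only [map_sub, map_smul, inner_sub_left, inner_sub_right, inner_smul_left,
      inner_smul_right, hu, hv, Complex.sub_re, Complex.sub_im, Complex.mul_re,
      Complex.mul_im, u, v] at h1 h2
    have h3 : 0 ≤ s * ((inner ℂ x (T x)).re + (inner ℂ y (T y)).re -
        2 * c * (inner ℂ y (T x)).re) := by
      have hsc' : c ^ 2 = 1 - s ^ 2 := by linarith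
      ring_nf at h1 h2 ⊢
      simp only [hsc', show c ^ 3 = c * (1 - s ^ 2) by rw [← hsc']; ring] at h1 h2
      nlinarith
    linarith [nonneg_of_mul_nonneg_right h3 hs]

/-- An operator with numerical range in a sector of half-angle `δ` has norm at most `sec δ` times
any bound of the real part of its quadratic form. -/
theorem opNorm_le_div_cos {E : Type*} [NormedAddCommGroup E] [InnerProductSpace ℂ E]
    (T : E →L[ℂ] E) {δ w : ℝ} (hδ0 : 0 ≤ δ) (hδ : δ < Real.pi / 2) (hw : 0 ≤ w)
    (hre : ∀ x, 0 ≤ (inner ℂ x (T x)).re)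
    (him : ∀ x, |(inner ℂ x (T x)).im| * Real.cos δ ≤ Real.sin δ * (inner ℂ x (T x)).re)
    (hT : ∀ x, (inner ℂ x (T x)).re ≤ w * ‖x‖ ^ 2) : ‖T‖ ≤ w / Real.cos δ := by
  have hc : 0 < Real.cos δ := Real.cos_pos_of_mem_Ioo ⟨by linarith [Real.pi_pos], hδ⟩
  refine T.opNorm_le_bound (div_nonneg hw hc.le) fun x => ?_
  rcases eq_or_ne (T x) 0 with h0 | h0
  · rw [h0, norm_zero]; positivity
  have hx : 0 < ‖x‖ := norm_pos_iff.mpr fun h => h0 (by rw [h, map_zero])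
  have hTx : 0 < ‖T x‖ := norm_pos_iff.mpr h0
  -- The multiple of Tx of norm ‖x‖: the mixed inequality then reads 2 cos δ ‖x‖ ‖Tx‖ ≤ 2w ‖x‖².
  set y : E := ((‖x‖ / ‖T x‖ : ℝ) : ℂ) • T x
  have hy : ‖y‖ = ‖x‖ := by
    rw [norm_smul, Complex.norm_real, Real.norm_of_nonneg (by positivity)]
    field_simp
  have hin : (inner ℂ y (T x)).re = ‖x‖ * ‖T x‖ := by
    have h1 : (inner ℂ (T x) (T x)).re = ‖T x‖ ^ 2 := inner_self_eq_norm_sq (𝕜 := ℂ) (T x)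
    rw [inner_smul_left, Complex.conj_ofReal, Complex.re_ofReal_mul, h1]
    field_simp
  have h1 := two_mul_cos_mul_re_inner_le T hδ0 hδ hre him x y
  have h2 := hT y
  rw [hy] at h2
  rw [hin] at h1
  rw [div_mul_eq_mul_div, le_div_iff₀ hc]
  nlinarith [hT x]

/-! ### The numerical radius of a square -/

theorem norm_quadForm_le {d : ℕ} (A : Matrix (Fin d) (Fin d) ℂ) (x : EuclideanSpace ℂ (Fin d)) :
    ‖quadForm A x‖ ≤ ‖Matrix.toEuclideanCLM (𝕜 := ℂ) A‖ * ‖x‖ ^ 2 := by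
  refine (norm_inner_le_norm _ _).trans ?_
  nlinarith [(Matrix.toEuclideanCLM (𝕜 := ℂ) A).le_opNorm x, norm_nonneg x]

theorem numRadius_nonneg {d : ℕ} (A : Matrix (Fin d) (Fin d) ℂ) : 0 ≤ numRadius A :=
  Real.sSup_nonneg fun _ ⟨_, _, hr⟩ => hr ▸ norm_nonneg _

theorem numRadius_le_opNorm {d : ℕ} (A : Matrix (Fin d) (Fin d) ℂ) :
    numRadius A ≤ ‖Matrix.toEuclideanCLM (𝕜 := ℂ) A‖ := by
  refine Real.sSup_le (fun r ⟨x, hx, hr⟩ => ?_) (norm_nonneg _)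
  rw [← hr]
  simpa [hx] using norm_quadForm_le A x

theorem quadForm_real_smul {d : ℕ} (A : Matrix (Fin d) (Fin d) ℂ) (r : ℝ)
    (x : EuclideanSpace ℂ (Fin d)) : quadForm A ((r : ℂ) • x) = ((r ^ 2 : ℝ) : ℂ) * quadForm A x := by
  rw [quadForm, map_smul, inner_smul_left, inner_smul_right, Complex.conj_ofReal, quadForm]
  push_cast
  ring

/-- The quadratic form takes the value `0` or a positive multiple of a point of the numerical
range. -/
theorem quadForm_eq_mul_of_ne_zero {d : ℕ} (A : Matrix (Fin d) (Fin d) ℂ)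
    {x : EuclideanSpace ℂ (Fin d)} (hx : x ≠ 0) : ∃ y : EuclideanSpace ℂ (Fin d), ‖y‖ = 1 ∧
      quadForm A x = ((‖x‖ ^ 2 : ℝ) : ℂ) * quadForm A y := by
  have h0 : ‖x‖ ≠ 0 := norm_ne_zero_iff.mpr hx
  refine ⟨((‖x‖⁻¹ : ℝ) : ℂ) • x, by rw [norm_smul]; simp [h0], ?_⟩
  rw [← quadForm_real_smul, smul_smul, ← Complex.ofReal_mul, mul_inv_cancel₀ h0, Complex.ofReal_one,
    one_smul]

theorem norm_quadForm_le_numRadius {d : ℕ} (A : Matrix (Fin d) (Fin d) ℂ)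
    (x : EuclideanSpace ℂ (Fin d)) : ‖quadForm A x‖ ≤ numRadius A * ‖x‖ ^ 2 := by
  rcases eq_or_ne x 0 with rfl | hx
  · simp [quadForm]
  obtain ⟨y, hy, hxy⟩ := quadForm_eq_mul_of_ne_zero A hx
  have hle : ‖quadForm A y‖ ≤ numRadius A := by
    refine le_csSup ⟨‖Matrix.toEuclideanCLM (𝕜 := ℂ) A‖, ?_⟩ ⟨y, hy, rfl⟩
    rintro r ⟨z, hz, rfl⟩
    simpa [hz] using norm_quadForm_le A z
  rw [hxy, norm_mul, Complex.norm_real, Real.norm_of_nonneg (by positivity), mul_comm]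
  gcongr

theorem inner_toEuclideanCLM_smul {d : ℕ} (A : Matrix (Fin d) (Fin d) ℂ) (u : ℂ)
    (x : EuclideanSpace ℂ (Fin d)) :
    inner ℂ x ((u • Matrix.toEuclideanCLM (𝕜 := ℂ) A) x) = u * quadForm A x := by
  simp [quadForm]

theorem exp_neg_mul_I_mul_im (φ : ℝ) (z : ℂ) :
    (Complex.exp (-φ * Complex.I) * z).im = Real.cos φ * z.im - Real.sin φ * z.re := by
  rw [← Complex.ofReal_neg, Complex.mul_im, Complex.exp_ofReal_mul_I_re,
    Complex.exp_ofReal_mul_I_im, Real.cos_neg, Real.sin_neg]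
  ring

theorem exp_neg_mul_I_mul_re (φ : ℝ) (z : ℂ) :
    (Complex.exp (-φ * Complex.I) * z).re = Real.cos φ * z.re + Real.sin φ * z.im := by
  rw [← Complex.ofReal_neg, Complex.mul_re, Complex.exp_ofReal_mul_I_re,
    Complex.exp_ofReal_mul_I_im, Real.cos_neg, Real.sin_neg]
  ring

/-- If the numerical range of `B` lies in the sector of half-angle `δ` about the direction `m`, then
`w(B²) ≤ sec² δ w(B)²`. -/
theorem numRadius_mul_self_le {d : ℕ} (B : Matrix (Fin d) (Fin d) ℂ) {δ m : ℝ} (hδ0 : 0 ≤ δ)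
    (hδ : δ < Real.pi / 2)
    (hre : ∀ x, 0 ≤ Real.cos m * (quadForm B x).re + Real.sin m * (quadForm B x).im)
    (hlo : ∀ x, 0 ≤ Real.cos (m - δ) * (quadForm B x).im - Real.sin (m - δ) * (quadForm B x).re)
    (hhi : ∀ x, Real.cos (m + δ) * (quadForm B x).im - Real.sin (m + δ) * (quadForm B x).re ≤ 0) :
    numRadius (B * B) ≤ (numRadius B / Real.cos δ) ^ 2 := by
  set T := Matrix.toEuclideanCLM (𝕜 := ℂ) B
  -- This rotation centres the sector on the positive real axis without changing norms.
  set u : ℂ := Complex.exp (-m * Complex.I)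
  have hu : ‖u‖ = 1 := by
    simpa [u] using Complex.norm_exp_ofReal_mul_I (-m)
  have hnorm : ‖u • T‖ ≤ numRadius B / Real.cos δ := by
    refine opNorm_le_div_cos _ hδ0 hδ (numRadius_nonneg B) (fun x => ?_) (fun x => ?_) fun x => ?_
    · rw [inner_toEuclideanCLM_smul, exp_neg_mul_I_mul_re]
      exact hre x
    · rw [inner_toEuclideanCLM_smul, exp_neg_mul_I_mul_re, exp_neg_mul_I_mul_im]
      have h1 := hlo x
      have h2 := hhi x
      rw [Real.cos_sub, Real.sin_sub] at h1
      rw [Real.cos_add, Real.sin_add] at h2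
      have hc : 0 < Real.cos δ := Real.cos_pos_of_mem_Ioo ⟨by linarith [Real.pi_pos], hδ⟩
      nth_rw 1 [← abs_of_pos hc]
      rw [← abs_mul, abs_le]
      constructor <;> linarith
    · rw [inner_toEuclideanCLM_smul]
      refine (Complex.re_le_norm _).trans ?_
      rw [norm_mul, hu, one_mul]
      exact norm_quadForm_le_numRadius B x
  rw [norm_smul, hu, one_mul] at hnorm
  refine (numRadius_le_opNorm _).trans ?_
  rw [map_mul, sq]
  exact (norm_mul_le _ _).trans (mul_self_le_mul_self (norm_nonneg _) hnorm)

/-! ### Iterated square roots: halved angles and chained estimates -/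

/-- Half-planes containing the numerical range are inherited by square roots, with half the
angle. -/
theorem im_quadForm_nonneg_of_mul_self {d : ℕ} {B : Matrix (Fin d) (Fin d) ℂ} {ψ σ : ℝ}
    (hspec : ∀ z ∈ spectrum ℂ B, 0 < (Complex.exp (-ψ * Complex.I) * z).re)
    (h : ∀ x, 0 ≤ σ * (Real.cos (2 * ψ) * (quadForm (B * B) x).im -
      Real.sin (2 * ψ) * (quadForm (B * B) x).re)) (x : EuclideanSpace ℂ (Fin d)) :
    0 ≤ σ * (Real.cos ψ * (quadForm B x).im - Real.sin ψ * (quadForm B x).re) := by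
  set u : ℂ := Complex.exp (-ψ * Complex.I) with hu
  have hu0 : u ≠ 0 := Complex.exp_ne_zero _
  -- The square of the rotated operator e^(-iψ)B is e^(-2iψ)B², which is why the angle halves.
  have key := im_inner_nonneg_of_im_inner_mul_self (u • Matrix.toEuclideanCLM (𝕜 := ℂ) B)
    (fun z hz => ?_) σ (fun y => ?_) x
  · rwa [inner_toEuclideanCLM_smul, exp_neg_mul_I_mul_im] at key
  · have hsp := spectrum.unit_smul_eq_smul (R := ℂ) (Matrix.toEuclideanCLM (𝕜 := ℂ) B)
      (Units.mk0 u hu0)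
    simp only [Units.smul_def, Units.val_mk0] at hsp
    rw [hsp, AlgEquiv.spectrum_eq] at hz
    obtain ⟨l, hl, rfl⟩ := hz
    exact hspec l hl
  · have huu : u * u = Complex.exp (-(2 * ψ : ℝ) * Complex.I) := by
      rw [hu, ← Complex.exp_add]
      push_cast
      ring_nf
    rw [smul_mul_smul_comm, ← map_mul, inner_toEuclideanCLM_smul, huu, exp_neg_mul_I_mul_im]
    exact h y

theorem matPow_mul_self {d : ℕ} {A : Matrix (Fin d) (Fin d) ℂ}
    (h : ∃ p : ℂ × ℝ, IsAdmissibleCircle A p.1 p.2) (n : ℕ) :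
    matPow A (1 / 2 ^ (n + 1)) * matPow A (1 / 2 ^ (n + 1)) = matPow A (1 / 2 ^ n) := by
  rw [← matPow_add h]
  congr 1
  ring

/-- Half-planes containing the numerical range of `A` pass to the iterated square roots of `A`. -/
theorem im_quadForm_matPow_nonneg {d : ℕ} {A : Matrix (Fin d) (Fin d) ℂ}
    (hA : numRange A ⊆ {z : ℂ | 0 < z.re}) {φ σ : ℝ} (hφ : |φ| < Real.pi / 2)
    (h : ∀ x, 0 ≤ σ * (Real.cos φ * (quadForm A x).im - Real.sin φ * (quadForm A x).re)) (n : ℕ) :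
    ∀ x, 0 ≤ σ * (Real.cos (φ / 2 ^ n) * (quadForm (matPow A (1 / 2 ^ n)) x).im -
      Real.sin (φ / 2 ^ n) * (quadForm (matPow A (1 / 2 ^ n)) x).re) := by
  have hex := exists_isAdmissibleCircle A hA
  induction n with
  | zero => simpa [matPow_one hex] using h
  | succ n ih =>
    refine im_quadForm_nonneg_of_mul_self (fun z hz => ?_) ?_
    -- The rotated eigenvalue has argument (arg l - φ)/2^(n+1), below π/2 in modulus since |arg l|
    -- and |φ| are.
    · obtain ⟨l, hl, rfl⟩ := exists_cpow_eq_of_mem_spectrum_matPow hex _ hz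
      have hlre : 0 < l.re := hA (spectrum_subset_numRange A hl)
      have hl0 : l ≠ 0 := by rintro rfl; simp at hlre
      have harg : |l.arg| < Real.pi / 2 := Complex.abs_arg_lt_pi_div_two_iff.mpr (Or.inl hlre)
      rw [Complex.cpow_def_of_ne_zero hl0, ← Complex.exp_add, Complex.exp_re]
      refine mul_pos (Real.exp_pos _) (Real.cos_pos_of_mem_Ioo ?_)
      have him : (-((φ / 2 ^ (n + 1) : ℝ) : ℂ) * Complex.I +
          Complex.log l * ((1 / 2 ^ (n + 1) : ℝ) : ℂ)).im = (l.arg - φ) / 2 ^ (n + 1) := by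
        rw [Complex.add_im, mul_comm (Complex.log l), Complex.im_ofReal_mul,
          Complex.log_im, ← Complex.ofReal_neg, Complex.im_ofReal_mul, Complex.I_im]
        ring
      have hpow : (2 : ℝ) ≤ 2 ^ (n + 1) := by
        rw [pow_succ]; linarith [one_le_pow₀ (n := n) (one_le_two : (1 : ℝ) ≤ 2)]
      rw [him, Set.mem_Ioo, ← abs_lt, abs_div, abs_of_pos (by positivity : (0 : ℝ) < 2 ^ (n + 1)),
        div_lt_iff₀ (by positivity)]
      nlinarith [abs_sub l.arg φ, Real.pi_pos]
    · rw [matPow_mul_self hex, show 2 * (φ / 2 ^ (n + 1)) = φ / 2 ^ n by ring]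
      exact ih

/-- Inserting the next estimate and taking a square root halves all earlier exponents and gives the
new factor the exponent 1/2. -/
theorem rpow_le_prod_mul_of_le_mul_sq {f w : ℕ → ℝ} (hf : ∀ n, 0 ≤ f n) (hw : ∀ n, 0 ≤ w n)
    (h : ∀ n, w n ≤ f (n + 1) * w (n + 1) ^ 2) (n : ℕ) :
    w 0 ^ ((1 : ℝ) / 2 ^ n) ≤
      (∏ i ∈ Finset.Icc 1 n, f i ^ ((1 : ℝ) / 2 ^ (n + 1 - i))) * w n := by
  induction n with
  | zero => simp
  | succ n ih =>
    have hprod : ∏ i ∈ Finset.Icc 1 n, f i ^ ((1 : ℝ) / 2 ^ (n + 1 + 1 - i)) =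
        (∏ i ∈ Finset.Icc 1 n, f i ^ ((1 : ℝ) / 2 ^ (n + 1 - i))) ^ ((1 : ℝ) / 2) := by
      rw [← Real.finsetProd_rpow _ _ fun i _ => Real.rpow_nonneg (hf i) _]
      refine Finset.prod_congr rfl fun i hi => ?_
      -- The bound i ≤ n keeps the truncated subtraction exact, so the power of 2 gains one factor.
      rw [← Real.rpow_mul (hf i), Nat.sub_add_comm (by have := (Finset.mem_Icc.mp hi).2; omega),
        pow_succ]
      congr 1
      field_simp
    have hP : 0 ≤ ∏ i ∈ Finset.Icc 1 n, f i ^ ((1 : ℝ) / 2 ^ (n + 1 - i)) :=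
      Finset.prod_nonneg fun i _ => Real.rpow_nonneg (hf i) _
    rw [Finset.prod_Icc_succ_top (by omega), hprod, Nat.add_sub_cancel_left, pow_one]
    calc w 0 ^ ((1 : ℝ) / 2 ^ (n + 1)) = (w 0 ^ ((1 : ℝ) / 2 ^ n)) ^ ((1 : ℝ) / 2) := by
          rw [← Real.rpow_mul (hw 0), pow_succ]
          congr 1
          field_simp
      _ ≤ ((∏ i ∈ Finset.Icc 1 n, f i ^ ((1 : ℝ) / 2 ^ (n + 1 - i))) *
            (f (n + 1) * w (n + 1) ^ 2)) ^ ((1 : ℝ) / 2) := by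
          refine Real.rpow_le_rpow (Real.rpow_nonneg (hw 0) _) (ih.trans ?_) (by norm_num)
          gcongr
          exact h n
      _ = _ := by
          rw [Real.mul_rpow hP (mul_nonneg (hf _) (sq_nonneg _)),
            Real.mul_rpow (hf _) (sq_nonneg _), ← Real.sqrt_eq_rpow (w (n + 1) ^ 2),
            Real.sqrt_sq (hw _), mul_assoc]

/-! ### Sectorial and accretive-dissipative matrices -/

open scoped ComplexOrder in
theorem quadForm_nonneg_of_posDef {d : ℕ} {M : Matrix (Fin d) (Fin d) ℂ} (hM : M.PosDef)
    (x : EuclideanSpace ℂ (Fin d)) : 0 ≤ quadForm M x := by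
  have h := hM.posSemidef.dotProduct_mulVec_nonneg x.ofLp
  rwa [quadForm, EuclideanSpace.inner_eq_star_dotProduct, dotProduct_comm]

theorem IsAccretiveDissipative.im_quadForm_nonneg {d : ℕ} {A : Matrix (Fin d) (Fin d) ℂ}
    (hA : IsAccretiveDissipative A) (x : EuclideanSpace ℂ (Fin d)) : 0 ≤ (quadForm A x).im := by
  have h1 := Complex.nonneg_iff.mp (quadForm_nonneg_of_posDef hA.1 x)
  have h2 := Complex.nonneg_iff.mp (quadForm_nonneg_of_posDef hA.2 x)
  have h3 : quadForm A x = quadForm (realPart A : Matrix (Fin d) (Fin d) ℂ) x +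
      Complex.I * quadForm (imaginaryPart A : Matrix (Fin d) (Fin d) ℂ) x := by
    conv_lhs => rw [← realPart_add_I_smul_imaginaryPart A]
    simp [quadForm]
  rw [h3, Complex.add_im, Complex.I_mul_im, ← h1.2, zero_add]
  exact h2.1

theorem IsSectorial.numRange_subset {d : ℕ} {γ : ℝ} {A : Matrix (Fin d) (Fin d) ℂ}
    (hA : IsSectorial γ A) : numRange A ⊆ {z : ℂ | 0 < z.re} :=
  fun _ hz => (hA.2 hz).1

/-- The sector condition, on all vectors and for every larger angle. -/
theorem IsSectorial.cos_mul_abs_im_le {d : ℕ} {γ : ℝ} {A : Matrix (Fin d) (Fin d) ℂ}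
    (hA : IsSectorial γ A) {θ : ℝ} (hγθ : γ ≤ θ) (hθ : θ < Real.pi / 2)
    (x : EuclideanSpace ℂ (Fin d)) :
    Real.cos θ * |(quadForm A x).im| ≤ Real.sin θ * (quadForm A x).re := by
  rcases eq_or_ne x 0 with rfl | hx
  · simp [quadForm]
  obtain ⟨y, hy, hxy⟩ := quadForm_eq_mul_of_ne_zero A hx
  obtain ⟨hre, him⟩ := hA.2 ⟨y, hy, rfl⟩
  have hγ := hA.1.1
  have hc : 0 < Real.cos θ := Real.cos_pos_of_mem_Ioo ⟨by linarith [Real.pi_pos], hθ⟩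
  have htan : Real.tan γ ≤ Real.tan θ :=
    Real.strictMonoOn_tan.monotoneOn ⟨by linarith [Real.pi_pos], by linarith⟩
      ⟨by linarith [Real.pi_pos], hθ⟩ hγθ
  have h1 : Real.cos θ * |(quadForm A y).im| ≤ Real.sin θ * (quadForm A y).re := by
    rw [← Real.tan_mul_cos hc.ne', mul_comm (Real.tan θ), mul_assoc]
    gcongr
    exact him.trans (by gcongr)
  rw [hxy, Complex.re_ofReal_mul, Complex.im_ofReal_mul, abs_mul, abs_of_nonneg (by positivity)]
  nlinarith [mul_le_mul_of_nonneg_left h1 (sq_nonneg ‖x‖)]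

/-- The iterated square roots of a sectorial matrix are sectorial of the corresponding fraction of
the angle. -/
theorem IsSectorial.cos_mul_abs_im_matPow_le {d : ℕ} {γ : ℝ} {A : Matrix (Fin d) (Fin d) ℂ}
    (hA : IsSectorial γ A) {θ : ℝ} (hγθ : γ ≤ θ) (hθ : θ < Real.pi / 2) (n : ℕ)
    (x : EuclideanSpace ℂ (Fin d)) :
    Real.cos (θ / 2 ^ n) * |(quadForm (matPow A (1 / 2 ^ n)) x).im| ≤
      Real.sin (θ / 2 ^ n) * (quadForm (matPow A (1 / 2 ^ n)) x).re := by
  have hγ := hA.1.1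
  have hlo := im_quadForm_matPow_nonneg hA.numRange_subset (φ := -θ) (σ := 1)
    (by rw [abs_neg, abs_of_nonneg (hγ.trans hγθ)]; exact hθ) (fun y => by
      have h1 := hA.cos_mul_abs_im_le hγθ hθ y
      have hc : 0 < Real.cos θ := Real.cos_pos_of_mem_Ioo ⟨by linarith [Real.pi_pos], hθ⟩
      rw [Real.cos_neg, Real.sin_neg]
      nlinarith [neg_abs_le (quadForm A y).im]) n x
  have hhi := im_quadForm_matPow_nonneg hA.numRange_subset (φ := θ) (σ := -1)
    (by rw [abs_of_nonneg (hγ.trans hγθ)]; exact hθ) (fun y => by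
      have h1 := hA.cos_mul_abs_im_le hγθ hθ y
      have hc : 0 < Real.cos θ := Real.cos_pos_of_mem_Ioo ⟨by linarith [Real.pi_pos], hθ⟩
      nlinarith [le_abs_self (quadForm A y).im]) n x
  rw [neg_div, Real.cos_neg, Real.sin_neg] at hlo
  rcases abs_cases (quadForm (matPow A (1 / 2 ^ n)) x).im with ⟨h, -⟩ | ⟨h, -⟩ <;> rw [h] <;>
    linarith

theorem IsSectorial.re_matPow_nonneg {d : ℕ} {γ : ℝ} {A : Matrix (Fin d) (Fin d) ℂ}
    (hA : IsSectorial γ A) (n : ℕ) (x : EuclideanSpace ℂ (Fin d)) :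
    0 ≤ (quadForm (matPow A (1 / 2 ^ n)) x).re := by
  obtain ⟨hγ0, hγ⟩ := hA.1
  -- For γ = 0 the sector inequality carries no information on the real part, as sin 0 = 0; a
  -- strictly larger angle makes the sine positive.
  obtain ⟨θ, hγθ, hθ⟩ := exists_between hγ
  have hθ0 : 0 < θ := hγ0.trans_lt hγθ
  have h := hA.cos_mul_abs_im_matPow_le hγθ.le hθ n x
  have hle : θ / 2 ^ n ≤ θ := div_le_self hθ0.le (one_le_pow₀ one_le_two)
  have hpos : 0 < θ / 2 ^ n := by positivity
  have hs : 0 < Real.sin (θ / 2 ^ n) := Real.sin_pos_of_pos_of_lt_pi hpos (by linarith)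
  have hc : 0 < Real.cos (θ / 2 ^ n) := Real.cos_pos_of_mem_Ioo ⟨by linarith, by linarith⟩
  exact nonneg_of_mul_nonneg_right ((mul_nonneg hc.le (abs_nonneg _)).trans h) hs

/-! ### Trigonometric comparisons and conclusion -/

/-- The right-hand side equals 1 + sin² δ cos 2δ. -/
theorem one_le_one_add_two_mul_sin_sq_mul_cos_sq {δ : ℝ} (hδ0 : 0 ≤ δ) (hδ : δ ≤ Real.pi / 4) :
    1 ≤ (1 + 2 * Real.sin δ ^ 2) * Real.cos δ ^ 2 := by
  have h1 : 0 ≤ Real.cos (2 * δ) :=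
    Real.cos_nonneg_of_mem_Icc ⟨by linarith [Real.pi_pos], by linarith⟩
  rw [Real.cos_two_mul'] at h1
  have h2 := Real.sin_sq_add_cos_sq δ
  have h3 := mul_nonneg (sq_nonneg (Real.sin δ)) h1
  rw [show Real.cos δ ^ 2 = 1 - Real.sin δ ^ 2 by linarith] at h3 ⊢
  linarith

/-- With c = cos δ, the right-hand side exceeds 1 by c(1 - c)(2 + c)/2. -/
theorem one_le_one_add_sin_sq_mul_cos_half_sq {δ : ℝ} (hδ0 : 0 ≤ δ) (hδ : δ ≤ Real.pi / 2) :
    1 ≤ (1 + Real.sin δ ^ 2) * Real.cos (δ / 2) ^ 2 := by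
  have hc : 0 ≤ Real.cos δ := Real.cos_nonneg_of_mem_Icc ⟨by linarith [Real.pi_pos], hδ⟩
  have hc1 := Real.cos_le_one δ
  rw [Real.cos_sq, mul_div_cancel₀ δ two_ne_zero, Real.sin_sq]
  nlinarith [mul_nonneg (mul_nonneg hc (sub_nonneg.mpr hc1)) (by linarith : 0 ≤ 2 + Real.cos δ)]

theorem div_sq_le_mul_sq {f c w : ℝ} (hc : 0 < c) (h : 1 ≤ f * c ^ 2) : (w / c) ^ 2 ≤ f * w ^ 2 := by
  rw [div_pow, div_le_iff₀ (by positivity)]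
  nlinarith [mul_le_mul_of_nonneg_right h (sq_nonneg w)]

theorem theorem2p12 {d : ℕ} (γ : ℝ) (A : Matrix (Fin d) (Fin d) ℂ) (hA : IsSectorial γ A) :
    (∀ n : ℕ,
      numRadius A ^ ((1 : ℝ) / 2 ^ n) ≤
        (∏ i ∈ Finset.Icc 1 n,
          (1 + 2 * Real.sin (γ / 2 ^ i) ^ 2) ^ ((1 : ℝ) / 2 ^ (n + 1 - i))) *
        numRadius (matPow A ((1 : ℝ) / 2 ^ n))) ∧
    (IsAccretiveDissipative A → ∀ n : ℕ,
      numRadius A ^ ((1 : ℝ) / 2 ^ n) ≤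
        (∏ i ∈ Finset.Icc 1 n,
          (1 + Real.sin (γ / 2 ^ i) ^ 2) ^ ((1 : ℝ) / 2 ^ (n + 1 - i))) *
        numRadius (matPow A ((1 : ℝ) / 2 ^ n))) := by
  obtain ⟨hγ0, hγ⟩ := hA.1
  have hex := exists_isAdmissibleCircle A hA.numRange_subset
  have hw0 : numRadius (matPow A (1 / 2 ^ 0)) = numRadius A := by
    rw [pow_zero, div_one, matPow_one hex]
  have hδ0 : ∀ n : ℕ, 0 ≤ γ / 2 ^ (n + 1) := fun n => by positivity
  have hδ : ∀ n : ℕ, γ / 2 ^ (n + 1) ≤ Real.pi / 4 := fun n => by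
    have h1 : γ / 2 ^ n ≤ γ := div_le_self hγ0 (one_le_pow₀ one_le_two)
    rw [pow_succ, ← div_div]
    linarith
  have hpi := Real.pi_pos
  refine ⟨fun n => ?_, fun hAD n => ?_⟩
  · have key := rpow_le_prod_mul_of_le_mul_sq
      (f := fun i => 1 + 2 * Real.sin (γ / 2 ^ i) ^ 2)
      (w := fun n => numRadius (matPow A (1 / 2 ^ n)))
      (fun n => by positivity) (fun n => numRadius_nonneg _) (fun n => ?_) n
    · rwa [hw0] at key
    have hc : 0 < Real.cos (γ / 2 ^ (n + 1)) :=
      Real.cos_pos_of_mem_Ioo ⟨by linarith [hδ0 n], by linarith [hδ n]⟩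
    rw [← matPow_mul_self hex]
    refine (numRadius_mul_self_le _ (m := 0) (hδ0 n) (by linarith [hδ n]) (fun x => ?_)
      (fun x => ?_) fun x => ?_).trans
      (div_sq_le_mul_sq hc (one_le_one_add_two_mul_sin_sq_mul_cos_sq (hδ0 n) (hδ n)))
    · simpa using hA.re_matPow_nonneg (n + 1) x
    · have h := hA.cos_mul_abs_im_matPow_le le_rfl hγ (n + 1) x
      rw [zero_sub, Real.cos_neg, Real.sin_neg]
      nlinarith [neg_abs_le (quadForm (matPow A (1 / 2 ^ (n + 1))) x).im]
    · have h := hA.cos_mul_abs_im_matPow_le le_rfl hγ (n + 1) x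
      rw [zero_add]
      nlinarith [le_abs_self (quadForm (matPow A (1 / 2 ^ (n + 1))) x).im]
  · have key := rpow_le_prod_mul_of_le_mul_sq
      (f := fun i => 1 + Real.sin (γ / 2 ^ i) ^ 2)
      (w := fun n => numRadius (matPow A (1 / 2 ^ n)))
      (fun n => by positivity) (fun n => numRadius_nonneg _) (fun n => ?_) n
    · rwa [hw0] at key
    set δ := γ / 2 ^ (n + 1) with hδ_def
    have h0 : 0 ≤ δ := hδ0 n
    have h1 : δ ≤ Real.pi / 4 := hδ n
    have hc : 0 < Real.cos (δ / 2) :=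
      Real.cos_pos_of_mem_Ioo ⟨by linarith, by linarith⟩
    -- The real axis is the edge φ = 0, which halving leaves fixed.
    have him : ∀ x, 0 ≤ (quadForm (matPow A (1 / 2 ^ (n + 1))) x).im := fun x => by
      simpa using im_quadForm_matPow_nonneg hA.numRange_subset (φ := 0) (σ := 1)
        (by rw [abs_zero]; linarith) (fun y => by simpa using hAD.im_quadForm_nonneg y) (n + 1) x
    rw [← matPow_mul_self hex]
    -- The sector between the directions 0 and δ is centred at δ/2 and has half-angle δ/2.
    refine (numRadius_mul_self_le _ (m := δ / 2) (by linarith) (by linarith) (fun x => ?_)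
      (fun x => ?_) fun x => ?_).trans
      (div_sq_le_mul_sq hc (one_le_one_add_sin_sq_mul_cos_half_sq h0 (by linarith)))
    · exact add_nonneg (mul_nonneg hc.le (hA.re_matPow_nonneg (n + 1) x))
        (mul_nonneg (Real.sin_nonneg_of_nonneg_of_le_pi (by linarith) (by linarith)) (him x))
    · simpa using him x
    · have h := hA.cos_mul_abs_im_matPow_le le_rfl hγ (n + 1) x
      rw [abs_of_nonneg (him x)] at h
      rw [add_halves]
      exact sub_nonpos.mpr h
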